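/- Let $m>0$ and write $p=-i\,d/dx$ on $L^2(\mathbb R)$, so that for a real function $K$ the operator $K(p)$ is multiplication by $K(k)$ in the Fourier (momentum) variable $k$. Put $g(x)=2x-\sin 2x$ and $h(x)=\frac{1}{1+g(x)^2}$, and for $c>0$ let \[ f_c=\frac1{2mc}\Big(\sqrt{(p+1)^2+m^2c^2}+\sqrt{(p-1)^2+m^2c^2}\Big)h,\qquad u_c(x)=f_c(x)\sin x, \] \[ \lambda_c=c\big(\sqrt{1+m^2c^2}-mc\big),\qquad V_c(x)=\lambda_c-c\,\frac{\big(\sqrt{p^2+m^2c^2}-mc\big)u_c(x)}{u_c(x)} , \] where $f_c$ and $(\sqrt{p^2+m^2c^2}-mc)u_c$ are evaluated through their continuous representatives (these exist for every $c>0$, and $u_c\in C^2(\mathbb R)$). Let $u_\infty(x)=\sin(x)\,h(x)$. Then, as $c\to\infty$: (i) $u_c\to u_\infty$ uniformly in $C^2(\mathbb R)$, i.e. $\sup_{x\in\mathbb R}|u_c^{(j)}(x)-u_\infty^{(j)}(x)|\to0$ for $j=0,1,2$; (ii) $\lambda_c\to\frac1{2m}$; (iii) for every $x\in\mathbb R\setminus\pi\mathbb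 Z$, \[ V_c(x)\to\frac1{2m}\Big(1-\frac{p^2u_\infty(x)}{u_\infty(x)}\Big)=\frac1{2m}V_{\rm NW}(x), \] where $p^2u_\infty=-u_\infty''$ and $V_{\rm NW}$ is the Neumann–Wigner potential on the line, \[ V_{\rm NW}(x)=-32\,\frac{\sin|x|\,\big(g(|x|)^3\cos|x|-3g(|x|)^2\sin^3|x|+g(|x|)\cos|x|+\sin^3|x|\big)}{(1+g(|x|)^2)^2}. \] -/

import Mathlib

open MeasureTheory Filter
open scoped FourierTransform

noncomputable section

namespace NeumannWigner

/-- The Hilbert space `L²(ℝ)`. -/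
abbrev L2 : Type := Lp ℂ 2 (volume : Measure ℝ)

/-- The graph of the operator `K(p)` on `L²(ℝ)`, where `p = -i d/dx`: the pair `(Φ, Ψ)` satisfies
`Φ ∈ D(K(p))` and `K(p) Φ = Ψ` iff the Fourier transform of `Ψ` is the symbol `K` times that of `Φ`.
With the normalization `∫ exp(-2πixξ) Φ(x) dx` of the (Plancherel) Fourier transform, the operator
`p` becomes multiplication by `2πξ`. -/
def IsMomentumFun (K : ℝ → ℝ) (Φ Ψ : L2) : Prop :=
  (𝓕 Ψ : L2) =ᵐ[volume] fun ξ : ℝ => (K (2 * Real.pi * ξ) : ℂ) * (𝓕 Φ : L2) ξ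

/-- `φ` represents an element of the domain of `K(p)`, and `ψ` is the continuous representative of
its image under `K(p)`. -/
def HasMomentumFun (K : ℝ → ℝ) (φ ψ : ℝ → ℂ) : Prop :=
  Continuous ψ ∧ ∃ Φ Ψ : L2, (Φ : ℝ → ℂ) =ᵐ[volume] φ ∧ (Ψ : ℝ → ℂ) =ᵐ[volume] ψ ∧
    IsMomentumFun K Φ Ψ

/-- The continuous representative is unique. -/
theorem HasMomentumFun.unique {K : ℝ → ℝ} {φ ψ ψ' : ℝ → ℂ}
    (h : HasMomentumFun K φ ψ) (h' : HasMomentumFun K φ ψ') : ψ = ψ' := by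
  obtain ⟨hc, Φ, Ψ, h1, h2, h3⟩ := h
  obtain ⟨hc', Φ', Ψ', h1', h2', h3'⟩ := h'
  have e : Φ = Φ' := Lp.ext (h1.trans h1'.symm)
  subst e
  have e2 : (𝓕 Ψ : L2) = 𝓕 Ψ' := by
    refine Lp.ext ?_
    exact Filter.EventuallyEq.trans h3 (Filter.EventuallyEq.symm h3')
  have e3 : Ψ = Ψ' := (Lp.fourierTransformₗᵢ ℝ ℂ).injective e2
  subst e3
  exact (hc.ae_eq_iff_eq volume hc').1 (h2.symm.trans h2')

open Classical in
/-- The function `K(p) φ`, evaluated pointwise through its continuous representative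
(and `0` if there is none). -/
def momentumFun (K : ℝ → ℝ) (φ : ℝ → ℂ) : ℝ → ℂ :=
  if H : ∃ ψ, HasMomentumFun K φ ψ then H.choose else 0

/-- `p = -i d/dx` acting on differentiable functions. -/
def momentum (φ : ℝ → ℂ) : ℝ → ℂ := fun x => -Complex.I * deriv φ x

/-- `g(x) = 2x - sin 2x`. -/
def g (x : ℝ) : ℝ := 2 * x - Real.sin (2 * x)

/-- `h(x) = 1 / (1 + g(x)²)`, as a complex-valued function. -/
def h (x : ℝ) : ℂ := ((1 / (1 + g x ^ 2) : ℝ) : ℂ)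

/-- The symbol of `(1 / 2mc) (√((p + 1)² + m²c²) + √((p - 1)² + m²c²))`. -/
def symbolF (m c : ℝ) (k : ℝ) : ℝ :=
  1 / (2 * m * c) * (√((k + 1) ^ 2 + m ^ 2 * c ^ 2) + √((k - 1) ^ 2 + m ^ 2 * c ^ 2))

/-- The symbol of `√(p² + m²c²) - mc`. -/
def symbolKin (m c : ℝ) (k : ℝ) : ℝ := √(k ^ 2 + m ^ 2 * c ^ 2) - m * c

/-- The function `f_c`. -/
def f (m c : ℝ) : ℝ → ℂ := momentumFun (symbolF m c) h

/-- The eigenfunction `u_c`. -/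
def u (m c : ℝ) (x : ℝ) : ℂ := f m c x * (Real.sin x : ℂ)

/-- The eigenvalue `λ_c`. -/
def lam (m c : ℝ) : ℝ := c * (√(1 + m ^ 2 * c ^ 2) - m * c)

/-- The potential `V_c`. -/
def V (m c : ℝ) (x : ℝ) : ℂ :=
  (lam m c : ℂ) - (c : ℂ) * (momentumFun (symbolKin m c) (u m c) x / u m c x)

/-- The limit function `u_∞(x) = sin(x) h(x)`. -/
def uInf (x : ℝ) : ℂ := (Real.sin x : ℂ) * h x

/-- The classical Neumann–Wigner potential as a function on the line. -/
def VNW (x : ℝ) : ℝ :=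
  -32 * (Real.sin |x| * (g |x| ^ 3 * Real.cos |x| - 3 * g |x| ^ 2 * Real.sin |x| ^ 3
    + g |x| * Real.cos |x| + Real.sin |x| ^ 3)) / (1 + g |x| ^ 2) ^ 2

end NeumannWigner

end

noncomputable section

namespace NeumannWigner

/-! Everything happens on the Fourier side. Put K_c(k) = √(k² + m²c²) − mc, so that 0 ≤ K_c(k) ≤
k²/(2mc) and c·K_c(k) → k²/(2m); in particular λ_c = c·K_c(1). The symbol of f_c is 1 + (K_c(k+1) +
K_c(k−1))/(2mc), hence within (k² + 1)/(2m²c²) of 1 (`abs_symbolF_sub_one_le`). Multiplication by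
sin is a difference of two frequency shifts (`fourierInv_sinShift`), so the transforms of u_c and
u_∞ differ by at most 1/(2m²c²) times a fixed rapidly decaying majorant
(`norm_sinShift_fHat_sub_le`). Integrating this bound against powers of ξ gives uniform convergence
of every derivative; dominated convergence gives c·K_c(p)u_c → p²u_∞/(2m) pointwise
(`tendsto_kinetic`). Dividing by u_c, whose limit vanishes only on πℤ, gives V_c.

The analytic input is `rapidDecay_fourier_h`: 𝓕 h beats every polynomial because all derivatives of
h are integrable. It turns every object into an absolutely convergent inverse Fourier integral. The
closed form of the limit is a direct differentiation with g' = 4 sin². -/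

/-! ### Plancherel transform versus Fourier integral. -/

/-- The integral of `𝓕⁻ φ` against `a` is the integral of `φ` against `𝓕⁻ a`. -/
theorem integral_fourierInv_mul_eq_flip {φ a : ℝ → ℂ} (hφ : Integrable φ) (ha : Integrable a) :
    ∫ ξ, 𝓕⁻ φ ξ * a ξ = ∫ x, φ x * 𝓕⁻ a x := by
  have key := VectorFourier.integral_fourierIntegral_smul_eq_flip (μ := (volume : Measure ℝ))
    (ν := (volume : Measure ℝ)) (L := -innerₗ ℝ) (e := Real.fourierChar)
    Real.continuous_fourierChar (continuous_inner (𝕜 := ℝ) (E := ℝ)).neg hφ ha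
  have hflip : (-innerₗ ℝ).flip = -innerₗ ℝ := by
    ext; simp
  rw [hflip] at key
  exact key

/-- On integrable square-integrable functions the Plancherel inverse Fourier transform is given by
the inverse Fourier integral. -/
theorem coeFn_fourierInv_toLp {a : ℝ → ℂ} (ha : Integrable a) (ha2 : MemLp a 2) :
    ((𝓕⁻ (ha2.toLp a) : L2) : ℝ → ℂ) =ᵐ[volume] 𝓕⁻ a := by
  have hcont : Continuous (𝓕⁻ a) :=
    VectorFourier.fourierIntegral_continuous Real.continuous_fourierChar
      (continuous_inner (𝕜 := ℝ) (E := ℝ)).neg ha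
  refine ae_eq_of_integral_contDiff_smul_eq
    ((Lp.memLp (𝓕⁻ (ha2.toLp a) : L2)).locallyIntegrable (by norm_num))
    hcont.locallyIntegrable fun φ hφ hφc => ?_
  have h1 : HasCompactSupport (Complex.ofRealCLM ∘ φ) := hφc.comp_left rfl
  have h2 : ContDiff ℝ (⊤ : ℕ∞) (Complex.ofRealCLM ∘ φ) :=
    Complex.ofRealCLM.contDiff.comp hφ
  set ψ : SchwartzMap ℝ ℂ := h1.toSchwartzMap h2 with hψ
  have hψφ : ∀ x, ψ x = (φ x : ℂ) := fun x => rfl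
  calc ∫ x, φ x • (𝓕⁻ (ha2.toLp a) : L2) x
      = Lp.toTemperedDistribution (𝓕⁻ (ha2.toLp a) : L2) ψ := by
        simp [hψφ]
    _ = ∫ x, (𝓕⁻ ψ) x * (ha2.toLp a) x := by
        rw [← Lp.fourierInv_toTemperedDistribution_eq, TemperedDistribution.fourierInv_apply]
        simp
    _ = ∫ x, 𝓕⁻ (ψ : ℝ → ℂ) x * a x := by
        refine integral_congr_ae ?_
        filter_upwards [ha2.coeFn_toLp] with x hx
        rw [hx, SchwartzMap.fourierInv_coe]
    _ = ∫ x, ψ x * 𝓕⁻ a x := integral_fourierInv_mul_eq_flip ψ.integrable ha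
    _ = ∫ x, φ x • 𝓕⁻ a x := by simp [hψφ]

/-! ### Rapidly decaying functions and their inverse Fourier integrals. -/

/-- A continuous function on the line, all of whose polynomial multiples are bounded. -/
def RapidDecay (a : ℝ → ℂ) : Prop :=
  Continuous a ∧ ∀ n : ℕ, ∃ C : ℝ, ∀ ξ, (1 + ξ ^ 2) ^ n * ‖a ξ‖ ≤ C

namespace RapidDecay

variable {a b : ℝ → ℂ}

theorem sub (ha : RapidDecay a) (hb : RapidDecay b) : RapidDecay fun ξ => a ξ - b ξ := by
  refine ⟨ha.1.sub hb.1, fun n => ?_⟩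
  obtain ⟨A, hA⟩ := ha.2 n
  obtain ⟨B, hB⟩ := hb.2 n
  refine ⟨A + B, fun ξ => ?_⟩
  calc (1 + ξ ^ 2) ^ n * ‖a ξ - b ξ‖ ≤ (1 + ξ ^ 2) ^ n * (‖a ξ‖ + ‖b ξ‖) := by
        gcongr; exact norm_sub_le _ _
    _ ≤ A + B := by rw [mul_add]; exact add_le_add (hA ξ) (hB ξ)

/-- Multiplication by a continuous function of at most quadratic growth. -/
theorem mul (ha : RapidDecay a) {K : ℝ → ℂ} (hK : Continuous K) {A : ℝ}
    (hA : ∀ ξ, ‖K ξ‖ ≤ A * (1 + ξ ^ 2)) : RapidDecay fun ξ => K ξ * a ξ := by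
  refine ⟨hK.mul ha.1, fun n => ?_⟩
  obtain ⟨C, hC⟩ := ha.2 (n + 1)
  have hA0 : 0 ≤ A := by simpa using (norm_nonneg _).trans (hA 0)
  refine ⟨A * C, fun ξ => ?_⟩
  calc (1 + ξ ^ 2) ^ n * ‖K ξ * a ξ‖ = (1 + ξ ^ 2) ^ n * (‖K ξ‖ * ‖a ξ‖) := by rw [norm_mul]
    _ ≤ (1 + ξ ^ 2) ^ n * (A * (1 + ξ ^ 2) * ‖a ξ‖) := by gcongr; exact hA ξ
    _ = A * ((1 + ξ ^ 2) ^ (n + 1) * ‖a ξ‖) := by ring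
    _ ≤ A * C := by gcongr; exact hC ξ

theorem const_mul (ha : RapidDecay a) (z : ℂ) : RapidDecay fun ξ => z * a ξ :=
  ha.mul (K := fun _ => z) continuous_const (A := ‖z‖) fun ξ =>
    le_mul_of_one_le_right (norm_nonneg z) (by nlinarith [sq_nonneg ξ])

theorem comp_add (ha : RapidDecay a) (t : ℝ) : RapidDecay fun ξ => a (ξ + t) := by
  refine ⟨ha.1.comp (continuous_id.add continuous_const), fun n => ?_⟩
  obtain ⟨C, hC⟩ := ha.2 n
  refine ⟨(2 * (1 + t ^ 2)) ^ n * C, fun ξ => ?_⟩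
  -- The right side minus the left is 1 + (ξ + 2t)² + 2t²(ξ + t)².
  have h1 : 1 + ξ ^ 2 ≤ 2 * (1 + t ^ 2) * (1 + (ξ + t) ^ 2) := by
    nlinarith [sq_nonneg (ξ + 2 * t), sq_nonneg (t * (ξ + t))]
  calc (1 + ξ ^ 2) ^ n * ‖a (ξ + t)‖
      ≤ (2 * (1 + t ^ 2) * (1 + (ξ + t) ^ 2)) ^ n * ‖a (ξ + t)‖ := by gcongr
    _ = (2 * (1 + t ^ 2)) ^ n * ((1 + (ξ + t) ^ 2) ^ n * ‖a (ξ + t)‖) := by rw [mul_pow, mul_assoc]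
    _ ≤ (2 * (1 + t ^ 2)) ^ n * C := by gcongr; exact hC _

theorem integrable (ha : RapidDecay a) : Integrable a := by
  obtain ⟨C, hC⟩ := ha.2 1
  refine (integrable_inv_one_add_sq.const_mul C).mono' ha.1.aestronglyMeasurable
    (Eventually.of_forall fun ξ => ?_)
  rw [← div_eq_mul_inv, le_div_iff₀ (by positivity), mul_comm]
  simpa using hC ξ

theorem memLp_two (ha : RapidDecay a) : MemLp a 2 := by
  rw [memLp_two_iff_integrable_sq_norm ha.1.aestronglyMeasurable]
  obtain ⟨C, hC⟩ := ha.2 0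
  refine (ha.integrable.norm.const_mul C).mono' (by have := ha.1; fun_prop)
    (Eventually.of_forall fun ξ => ?_)
  have := hC ξ
  rw [pow_zero, one_mul] at this
  rw [Real.norm_of_nonneg (by positivity), sq]
  gcongr

theorem mul_id (ha : RapidDecay a) (z : ℂ) : RapidDecay fun ξ => z * ξ * a ξ := by
  refine ha.mul (by fun_prop) (A := ‖z‖) fun ξ => ?_
  rw [norm_mul, Complex.norm_real, Real.norm_eq_abs]
  gcongr
  nlinarith [sq_nonneg (|ξ| - 1), sq_abs ξ]

theorem pow_mul (ha : RapidDecay a) (z : ℂ) (n : ℕ) : RapidDecay fun ξ => (z * ξ) ^ n * a ξ := by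
  induction n with
  | zero => simpa using ha
  | succ n ih =>
    convert ih.mul_id z using 2 with ξ
    ring

theorem continuous_fourierInv (ha : RapidDecay a) : Continuous (𝓕⁻ a) :=
  VectorFourier.fourierIntegral_continuous Real.continuous_fourierChar
    (continuous_inner (𝕜 := ℝ) (E := ℝ)).neg ha.integrable

theorem hasDerivAt_fourierInv (ha : RapidDecay a) (x : ℝ) :
    HasDerivAt (𝓕⁻ a) (𝓕⁻ (fun ξ : ℝ => 2 * Real.pi * Complex.I * ξ * a ξ) x) x := by
  have h1 : Integrable fun ξ : ℝ => ξ • a ξ := by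
    simpa using (ha.mul_id 1).integrable
  have h2 := (Real.hasDerivAt_fourier ha.integrable h1 (-x)).scomp x (hasDerivAt_neg x)
  -- The reflection contributes a sign that turns the factor −2πiξ of the forward transform into
  -- 2πiξ.
  have h3 : 𝓕⁻ a = 𝓕 a ∘ Neg.neg := by
    ext y
    exact Real.fourierInv_eq_fourier_neg a y
  rw [h3, Real.fourierInv_eq_fourier_neg]
  refine h2.congr_deriv ?_
  rw [neg_one_smul, Real.fourier_real_eq, Real.fourier_real_eq, ← integral_neg]
  congr 1
  ext ξ
  rw [← smul_neg]
  congr 1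
  rw [smul_eq_mul]
  ring

theorem iteratedDeriv_fourierInv (ha : RapidDecay a) (n : ℕ) :
    iteratedDeriv n (𝓕⁻ a) = 𝓕⁻ (fun ξ : ℝ => (2 * Real.pi * Complex.I * ξ) ^ n * a ξ) := by
  induction n with
  | zero => simp
  | succ n ih =>
    rw [iteratedDeriv_succ, ih]
    ext x
    rw [((ha.pow_mul _ n).hasDerivAt_fourierInv x).deriv]
    exact congrArg (fun φ : ℝ → ℂ => 𝓕⁻ φ x) (by ext ξ; ring)

theorem contDiff_fourierInv (ha : RapidDecay a) (n : ℕ) : ContDiff ℝ n (𝓕⁻ a) := by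
  refine contDiff_of_differentiable_iteratedDeriv fun k _ x => ?_
  rw [ha.iteratedDeriv_fourierInv]
  exact ((ha.pow_mul _ k).hasDerivAt_fourierInv x).differentiableAt

/-- The bridge from the L² definition of K(p) to explicit integrals: Plancherel inversion holds
exactly in L², and its values agree a.e. with the continuous integral. -/
theorem hasMomentumFun (ha : RapidDecay a) (hb : RapidDecay b) {K : ℝ → ℝ}
    (hK : ∀ ξ, b ξ = K (2 * Real.pi * ξ) * a ξ) : HasMomentumFun K (𝓕⁻ a) (𝓕⁻ b) := by
  refine ⟨hb.continuous_fourierInv, 𝓕⁻ (ha.memLp_two.toLp a), 𝓕⁻ (hb.memLp_two.toLp b),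
    coeFn_fourierInv_toLp ha.integrable _, coeFn_fourierInv_toLp hb.integrable _, ?_⟩
  rw [IsMomentumFun, FourierInvPair.fourier_fourierInv_eq, FourierInvPair.fourier_fourierInv_eq]
  filter_upwards [ha.memLp_two.coeFn_toLp, hb.memLp_two.coeFn_toLp] with ξ h1 h2
  rw [h1, h2, hK]

end RapidDecay

/-! ### Evaluation of K(p)φ and rules for inverse Fourier integrals. -/

theorem HasMomentumFun.momentumFun_eq {K : ℝ → ℝ} {φ ψ : ℝ → ℂ} (H : HasMomentumFun K φ ψ) :
    momentumFun K φ = ψ := by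
  have hex : ∃ ψ, HasMomentumFun K φ ψ := ⟨ψ, H⟩
  rw [momentumFun, dif_pos hex]
  exact hex.choose_spec.unique H

theorem norm_fourierInv_le (a : ℝ → ℂ) (x : ℝ) : ‖𝓕⁻ a x‖ ≤ ∫ ξ, ‖a ξ‖ :=
  VectorFourier.norm_fourierIntegral_le_integral_norm _ _ _ _ _

theorem fourierInv_sub {a b : ℝ → ℂ} (ha : Integrable a) (hb : Integrable b) (x : ℝ) :
    𝓕⁻ (fun ξ => a ξ - b ξ) x = 𝓕⁻ a x - 𝓕⁻ b x := by
  simp only [Real.fourierInv_eq', smul_sub]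
  have hi : ∀ {c : ℝ → ℂ}, Integrable c → Integrable fun v : ℝ =>
      Complex.exp (↑(2 * Real.pi * inner ℝ v x) * Complex.I) • c v := fun {c} hc => by
    have he : Continuous fun v : ℝ =>
      Complex.exp (↑(2 * Real.pi * inner ℝ v x) * Complex.I) := by fun_prop
    refine hc.norm.mono' (he.aestronglyMeasurable.smul hc.1)
      (Eventually.of_forall fun v => ?_)
    rw [norm_smul, Complex.norm_exp_ofReal_mul_I, one_mul]
  exact integral_sub (hi ha) (hi hb)

theorem fourierInv_const_mul (a : ℝ → ℂ) (z : ℂ) (x : ℝ) :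
    𝓕⁻ (fun ξ => z * a ξ) x = z * 𝓕⁻ a x := by
  simp only [Real.fourierInv_eq', smul_eq_mul]
  rw [← integral_const_mul]
  congr 1
  ext v
  ring

theorem fourierInv_comp_add (a : ℝ → ℂ) (t x : ℝ) :
    𝓕⁻ (fun ξ => a (ξ + t)) x = Complex.exp (-(2 * Real.pi * t * x : ℝ) * Complex.I) * 𝓕⁻ a x := by
  simp only [Real.fourierInv_eq', smul_eq_mul]
  have key := integral_add_right_eq_self (μ := volume) (fun v : ℝ =>
    Complex.exp (↑(2 * Real.pi * inner ℝ (v - t) x) * Complex.I) * a v) t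
  simp only [add_sub_cancel_right] at key
  rw [key, ← integral_const_mul]
  congr 1
  ext v
  rw [← mul_assoc, ← Complex.exp_add]
  congr 2
  simp
  ring

/-- Dominated convergence for inverse Fourier integrals at a point. -/
theorem tendsto_fourierInv {a : ℝ → ℝ → ℂ} {b : ℝ → ℂ} {B : ℝ → ℝ}
    (hm : ∀ᶠ c in atTop, AEStronglyMeasurable (a c) volume) (hB : Integrable B)
    (hle : ∀ᶠ c in atTop, ∀ ξ, ‖a c ξ‖ ≤ B ξ)
    (hlim : ∀ ξ, Tendsto (fun c => a c ξ) atTop (nhds (b ξ))) (x : ℝ) :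
    Tendsto (fun c => 𝓕⁻ (a c) x) atTop (nhds (𝓕⁻ b x)) := by
  simp only [Real.fourierInv_eq']
  refine tendsto_integral_filter_of_dominated_convergence B ?_ ?_ hB
    (Eventually.of_forall fun ξ => (hlim ξ).const_smul _)
  · filter_upwards [hm] with c hc
    have he : Continuous fun v : ℝ =>
      Complex.exp (↑(2 * Real.pi * inner ℝ v x) * Complex.I) := by fun_prop
    exact he.aestronglyMeasurable.smul hc
  · filter_upwards [hle] with c hc
    refine Eventually.of_forall fun ξ => ?_
    rw [norm_smul, Complex.norm_exp_ofReal_mul_I, one_mul]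
    exact hc ξ

/-! ### Smoothness of h and rapid decay of its Fourier transform. -/

theorem one_add_g_sq_pos (x : ℝ) : 0 < 1 + g x ^ 2 := by positivity

theorem hasDerivAt_g (x : ℝ) : HasDerivAt g (2 - 2 * Real.cos (2 * x)) x := by
  have h1 : HasDerivAt (fun x : ℝ => 2 * x) 2 x := by
    simpa using (hasDerivAt_id x).const_mul (2 : ℝ)
  exact (h1.sub h1.sin).congr_deriv (by ring)

theorem hasDerivAt_inv_one_add_g_sq (x : ℝ) :
    HasDerivAt (fun y => 1 / (1 + g y ^ 2))
      (-2 * (2 - 2 * Real.cos (2 * x)) * (1 / (1 + g x ^ 2)) * (g x / (1 + g x ^ 2))) x := by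
  have hne := (one_add_g_sq_pos x).ne'
  have h1 := (((hasDerivAt_g x).pow 2).const_add 1).inv hne
  simp only [one_div]
  refine h1.congr_deriv ?_
  simp
  field_simp

/-- The algebra generated by the constants, `sin 2x`, `cos 2x`, `1 / (1 + g²)` and `g / (1 + g²)`.
It is closed under differentiation and consists of bounded functions. -/
inductive BoundedAlg : (ℝ → ℝ) → Prop
  | const (r : ℝ) : BoundedAlg fun _ => r
  | sin : BoundedAlg fun x => Real.sin (2 * x)
  | cos : BoundedAlg fun x => Real.cos (2 * x)
  | inv : BoundedAlg fun x => 1 / (1 + g x ^ 2)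
  | div : BoundedAlg fun x => g x / (1 + g x ^ 2)
  | add {φ ψ : ℝ → ℝ} : BoundedAlg φ → BoundedAlg ψ → BoundedAlg fun x => φ x + ψ x
  | mul {φ ψ : ℝ → ℝ} : BoundedAlg φ → BoundedAlg ψ → BoundedAlg fun x => φ x * ψ x

namespace BoundedAlg

theorem exists_bound {φ : ℝ → ℝ} (hφ : BoundedAlg φ) : ∃ C, ∀ x, |φ x| ≤ C := by
  induction hφ with
  | const r => exact ⟨|r|, fun _ => le_rfl⟩
  | sin => exact ⟨1, fun x => Real.abs_sin_le_one _⟩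
  | cos => exact ⟨1, fun x => Real.abs_cos_le_one _⟩
  | inv =>
    refine ⟨1, fun x => ?_⟩
    rw [abs_of_pos (by positivity), div_le_one (by positivity)]
    nlinarith [sq_nonneg (g x)]
  | div =>
    refine ⟨1, fun x => ?_⟩
    rw [abs_div, abs_of_pos (one_add_g_sq_pos x), div_le_one (by positivity)]
    nlinarith [sq_nonneg (|g x| - 1), sq_abs (g x)]
  | add _ _ h1 h2 =>
    obtain ⟨A, hA⟩ := h1
    obtain ⟨B, hB⟩ := h2
    exact ⟨A + B, fun x => (abs_add_le _ _).trans (add_le_add (hA x) (hB x))⟩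
  | mul _ _ h1 h2 =>
    obtain ⟨A, hA⟩ := h1
    obtain ⟨B, hB⟩ := h2
    refine ⟨A * B, fun x => ?_⟩
    rw [abs_mul]
    exact mul_le_mul (hA x) (hB x) (abs_nonneg _) ((abs_nonneg _).trans (hA x))

theorem deriv_g : BoundedAlg fun x => 2 + -2 * Real.cos (2 * x) :=
  (const 2).add ((const (-2)).mul cos)

theorem exists_hasDerivAt {φ : ℝ → ℝ} (hφ : BoundedAlg φ) :
    ∃ φ', BoundedAlg φ' ∧ ∀ x, HasDerivAt φ (φ' x) x := by
  induction hφ with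
  | const r => exact ⟨_, const 0, fun x => hasDerivAt_const x r⟩
  | sin =>
    refine ⟨_, (const 2).mul cos, fun x => ?_⟩
    have h1 : HasDerivAt (fun x : ℝ => 2 * x) 2 x := by
      simpa using (hasDerivAt_id x).const_mul (2 : ℝ)
    exact h1.sin.congr_deriv (by ring)
  | cos =>
    refine ⟨_, (const (-2)).mul sin, fun x => ?_⟩
    have h1 : HasDerivAt (fun x : ℝ => 2 * x) 2 x := by
      simpa using (hasDerivAt_id x).const_mul (2 : ℝ)
    exact h1.cos.congr_deriv (by ring)
  | inv =>
    refine ⟨_, (((const (-2)).mul deriv_g).mul inv).mul div, fun x => ?_⟩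
    exact (hasDerivAt_inv_one_add_g_sq x).congr_deriv (by ring)
  | div =>
    refine ⟨_, (deriv_g.mul inv).add
      ((((const (-2)).mul deriv_g).mul div).mul div), fun x => ?_⟩
    have h1 := (hasDerivAt_g x).mul (hasDerivAt_inv_one_add_g_sq x)
    -- The unbounded g is not in the algebra, but after differentiating this product it recombines
    -- with its denominator into (g/(1 + g²))².
    have h2 : (fun x => g x / (1 + g x ^ 2)) = fun x => g x * (1 / (1 + g x ^ 2)) := by
      ext; ring
    rw [h2]
    exact h1.congr_deriv (by ring)
  | add _ _ h1 h2 =>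
    obtain ⟨A, hA, hA'⟩ := h1
    obtain ⟨B, hB, hB'⟩ := h2
    exact ⟨_, hA.add hB, fun x => (hA' x).add (hB' x)⟩
  | mul h1' h2' h1 h2 =>
    obtain ⟨A, hA, hA'⟩ := h1
    obtain ⟨B, hB, hB'⟩ := h2
    exact ⟨_, (hA.mul h2').add (h1'.mul hB), fun x => (hA' x).mul (hB' x)⟩

theorem continuous {φ : ℝ → ℝ} (hφ : BoundedAlg φ) : Continuous φ := by
  obtain ⟨φ', -, h⟩ := hφ.exists_hasDerivAt
  exact continuous_iff_continuousAt.2 fun x => (h x).continuousAt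

/-- Differentiating 1/(1 + g²) reproduces it times the bounded factor −2g'·g/(1 + g²), so the
integrable weight survives every derivative. -/
theorem exists_hasDerivAt_inv_mul {ψ : ℝ → ℝ} (hψ : BoundedAlg ψ) :
    ∃ χ, BoundedAlg χ ∧ ∀ x, HasDerivAt (fun y => ((1 / (1 + g y ^ 2) * ψ y : ℝ) : ℂ))
      ((1 / (1 + g x ^ 2) * χ x : ℝ) : ℂ) x := by
  obtain ⟨ψ', hψ', h⟩ := hψ.exists_hasDerivAt
  refine ⟨_, hψ'.add ((((const (-2)).mul deriv_g).mul div).mul hψ), fun x => ?_⟩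
  exact (((hasDerivAt_inv_one_add_g_sq x).mul (h x)).congr_deriv (by ring)).ofReal_comp

end BoundedAlg

theorem exists_iteratedDeriv_h (n : ℕ) : ∃ ψ, BoundedAlg ψ ∧
    iteratedDeriv n h = fun x => ((1 / (1 + g x ^ 2) * ψ x : ℝ) : ℂ) := by
  induction n with
  | zero => exact ⟨_, .const 1, by ext x; simp [h]⟩
  | succ n ih =>
    obtain ⟨ψ, hψ, e⟩ := ih
    obtain ⟨χ, hχ, h1⟩ := hψ.exists_hasDerivAt_inv_mul
    refine ⟨χ, hχ, ?_⟩
    rw [iteratedDeriv_succ, e]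
    ext x
    exact (h1 x).deriv

theorem contDiff_h (n : ℕ) : ContDiff ℝ n h := by
  refine contDiff_of_differentiable_iteratedDeriv fun k _ x => ?_
  obtain ⟨ψ, hψ, e⟩ := exists_iteratedDeriv_h k
  obtain ⟨χ, -, h1⟩ := hψ.exists_hasDerivAt_inv_mul
  rw [e]
  exact (h1 x).differentiableAt

theorem inv_one_add_g_sq_le (x : ℝ) : 1 / (1 + g x ^ 2) ≤ 2 * (1 + x ^ 2)⁻¹ := by
  rw [← div_eq_mul_inv, div_le_div_iff₀ (by positivity) (by positivity)]
  have h1 := Real.neg_one_le_sin (2 * x)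
  have h2 := Real.sin_le_one (2 * x)
  have h3 : g x = 2 * x - Real.sin (2 * x) := rfl
  have h4 : Real.sin (2 * x) ^ 2 ≤ 1 := by nlinarith
  rw [h3]
  -- With s = sin 2x, the difference to bound is 1 + 7x² − 8xs + 2s² = (2/3)(3x − 2s)² + x² + (1 −
  -- (2/3)s²).
  nlinarith [sq_nonneg (3 * x - 2 * Real.sin (2 * x))]

theorem integrable_iteratedDeriv_h (n : ℕ) : Integrable (iteratedDeriv n h) := by
  obtain ⟨ψ, hψ, e⟩ := exists_iteratedDeriv_h n
  obtain ⟨C, hC⟩ := hψ.exists_bound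
  have hcont : Continuous fun x => ((1 / (1 + g x ^ 2) * ψ x : ℝ) : ℂ) :=
    Complex.continuous_ofReal.comp (BoundedAlg.inv.mul hψ).continuous
  rw [e]
  refine ((integrable_inv_one_add_sq.const_mul 2).mul_const C).mono'
    hcont.aestronglyMeasurable (Eventually.of_forall fun x => ?_)
  rw [Complex.norm_real, Real.norm_eq_abs, abs_mul, abs_of_pos (a := 1 / (1 + g x ^ 2))
    (by positivity)]
  exact mul_le_mul (inv_one_add_g_sq_le x) (hC x) (abs_nonneg _) (by positivity)

theorem integrable_h : Integrable h := by
  simpa using integrable_iteratedDeriv_h 0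

/-- Each derivative becomes a factor 2πiξ, so an integrable k-th derivative bounds |ξ|^k times the
transform. -/
theorem rapidDecay_fourier_h : RapidDecay (𝓕 h) := by
  refine ⟨VectorFourier.fourierIntegral_continuous Real.continuous_fourierChar
    (continuous_inner (𝕜 := ℝ) (E := ℝ)) integrable_h, fun n => ?_⟩
  have hpow : ∀ (k : ℕ) (ξ : ℝ), |ξ| ^ k * ‖𝓕 h ξ‖ ≤ ∫ x, ‖iteratedDeriv k h x‖ := fun k ξ => by
    have e := congrFun (Real.fourier_iteratedDeriv (N := k) (n := k) (contDiff_h k)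
      (fun j _ => integrable_iteratedDeriv_h j) le_rfl) ξ
    have hle : ‖𝓕 (iteratedDeriv k h) ξ‖ ≤ ∫ x, ‖iteratedDeriv k h x‖ :=
      VectorFourier.norm_fourierIntegral_le_integral_norm _ _ _ _ _
    rw [e, norm_smul, norm_pow] at hle
    refine le_trans ?_ hle
    gcongr
    simp only [norm_mul, Complex.norm_real, Real.norm_eq_abs, Complex.norm_I, mul_one,
      Complex.norm_ofNat, abs_of_pos Real.pi_pos]
    exact le_mul_of_one_le_left (abs_nonneg _) (by linarith [Real.pi_gt_three])
  -- Convexity gives (1 + ξ²)^n ≤ 2^(n−1)(1 + ξ^(2n)), which needs only the derivatives of orders 0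
  -- and 2n. For n = 0 truncated subtraction makes the factor 1, and the bound still holds.
  refine ⟨2 ^ (n - 1) * ((∫ x, ‖iteratedDeriv 0 h x‖) + ∫ x, ‖iteratedDeriv (2 * n) h x‖),
    fun ξ => ?_⟩
  calc (1 + ξ ^ 2) ^ n * ‖𝓕 h ξ‖
      ≤ 2 ^ (n - 1) * (1 ^ n + (ξ ^ 2) ^ n) * ‖𝓕 h ξ‖ := by
        gcongr
        exact add_pow_le zero_le_one (sq_nonneg ξ) n
    _ = 2 ^ (n - 1) * (|ξ| ^ 0 * ‖𝓕 h ξ‖ + |ξ| ^ (2 * n) * ‖𝓕 h ξ‖) := by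
        rw [pow_mul, sq_abs]; ring
    _ ≤ _ := by gcongr <;> exact hpow _ _

theorem fourierInv_fourier_h : 𝓕⁻ (𝓕 h) = h :=
  (contDiff_h 0).continuous.fourierInv_fourier_eq integrable_h rapidDecay_fourier_h.integrable

/-! ### Estimates and limits for the symbols. -/

theorem sqrt_sq_add_sq_sub_nonneg (y M : ℝ) : 0 ≤ √(y ^ 2 + M ^ 2) - M := by
  rw [sub_nonneg]
  exact Real.le_sqrt_of_sq_le (le_add_of_nonneg_left (sq_nonneg y))

theorem sqrt_sq_add_sq_sub_le (y : ℝ) {M : ℝ} (hM : 0 < M) :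
    √(y ^ 2 + M ^ 2) - M ≤ y ^ 2 / (2 * M) := by
  rw [sub_le_iff_le_add]
  refine Real.sqrt_le_iff.2 ⟨by positivity, ?_⟩
  have e : (y ^ 2 / (2 * M) + M) ^ 2 = y ^ 2 + M ^ 2 + (y ^ 2 / (2 * M)) ^ 2 := by
    field_simp
    ring
  rw [e]
  exact le_add_of_nonneg_right (sq_nonneg _)

section Symbols

variable {m c : ℝ}

theorem symbolKin_nonneg (m c k : ℝ) : 0 ≤ symbolKin m c k := by
  have := sqrt_sq_add_sq_sub_nonneg k (m * c)
  rwa [mul_pow] at this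

theorem symbolKin_le (hm : 0 < m) (hc : 0 < c) (k : ℝ) :
    symbolKin m c k ≤ k ^ 2 / (2 * (m * c)) := by
  have := sqrt_sq_add_sq_sub_le k (mul_pos hm hc)
  rwa [mul_pow] at this

theorem symbolF_sub_one (hm : 0 < m) (hc : 0 < c) (k : ℝ) :
    symbolF m c k - 1 = 1 / (2 * (m * c)) * (symbolKin m c (k + 1) + symbolKin m c (k - 1)) := by
  simp only [symbolF, symbolKin]
  field_simp
  ring

/-- The quadratic bounds at k + 1 and k − 1 add up through (k + 1)² + (k − 1)² = 2(k² + 1); this is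
the source of the rate c⁻². -/
theorem abs_symbolF_sub_one_le (hm : 0 < m) (hc : 0 < c) (k : ℝ) :
    |symbolF m c k - 1| ≤ 1 / (2 * m ^ 2 * c ^ 2) * (k ^ 2 + 1) := by
  rw [symbolF_sub_one hm hc, abs_of_nonneg
    (mul_nonneg (by positivity) (add_nonneg (symbolKin_nonneg _ _ _) (symbolKin_nonneg _ _ _)))]
  calc 1 / (2 * (m * c)) * (symbolKin m c (k + 1) + symbolKin m c (k - 1))
      ≤ 1 / (2 * (m * c)) * ((k + 1) ^ 2 / (2 * (m * c)) + (k - 1) ^ 2 / (2 * (m * c))) := by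
        gcongr <;> exact symbolKin_le hm hc _
    _ = 1 / (2 * m ^ 2 * c ^ 2) * (k ^ 2 + 1) := by
        field_simp
        ring

theorem mul_symbolKin_le (hm : 0 < m) (hc : 0 < c) (k : ℝ) :
    c * symbolKin m c k ≤ k ^ 2 / (2 * m) := by
  calc c * symbolKin m c k ≤ c * (k ^ 2 / (2 * (m * c))) := by
        gcongr
        exact symbolKin_le hm hc k
    _ = k ^ 2 / (2 * m) := by field_simp

/-- The relativistic kinetic energy tends to the nonrelativistic one. -/
theorem tendsto_mul_symbolKin (hm : 0 < m) (k : ℝ) :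
    Tendsto (fun c => c * symbolKin m c k) atTop (nhds (k ^ 2 / (2 * m))) := by
  have hlow : Tendsto (fun c : ℝ => k ^ 2 / (2 * m + k ^ 2 / (2 * m) * (c ^ 2)⁻¹)) atTop
      (nhds (k ^ 2 / (2 * m))) := by
    have h1 : Tendsto (fun c : ℝ => (c ^ 2)⁻¹) atTop (nhds 0) :=
      tendsto_inv_atTop_zero.comp (tendsto_pow_atTop two_ne_zero)
    have h2 := (h1.const_mul (k ^ 2 / (2 * m))).const_add (2 * m)
    rw [mul_zero, add_zero] at h2
    exact tendsto_const_nhds.div h2 (by positivity)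
  refine tendsto_of_tendsto_of_tendsto_of_le_of_le' hlow tendsto_const_nhds ?_ ?_
  · filter_upwards [eventually_gt_atTop 0] with c hc
    have h1 := symbolKin_nonneg m c k
    have h2 := symbolKin_le hm hc k
    -- Rationalizing the square root: K(K + 2mc) = k². Bounding the K in the second factor from
    -- above by k²/(2mc) then yields the lower bound.
    have h3 : symbolKin m c k * (symbolKin m c k + 2 * (m * c)) = k ^ 2 := by
      have := Real.sq_sqrt (show 0 ≤ k ^ 2 + m ^ 2 * c ^ 2 by positivity)
      simp only [symbolKin]
      linear_combination this
    rw [div_le_iff₀ (by positivity)]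
    have h4 : c * symbolKin m c k * (2 * m + k ^ 2 / (2 * m) * (c ^ 2)⁻¹)
        = symbolKin m c k * (k ^ 2 / (2 * (m * c)) + 2 * (m * c)) := by
      field_simp
      ring
    rw [h4, ← h3]
    gcongr
    rwa [h3]
  · filter_upwards [eventually_gt_atTop 0] with c hc
    exact mul_symbolKin_le hm hc k

theorem tendsto_lam (hm : 0 < m) : Tendsto (lam m) atTop (nhds (1 / (2 * m))) := by
  -- The eigenvalue is c times the kinetic symbol at k = 1.
  have h1 := tendsto_mul_symbolKin hm 1
  simp only [symbolKin, one_pow] at h1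
  exact h1

end Symbols

/-! ### The sine factor as a difference of frequency shifts. -/

/-- Multiplication by `sin` on the Fourier side. -/
def sinShift (a : ℝ → ℂ) (ξ : ℝ) : ℂ :=
  1 / (2 * Complex.I) * (a (ξ + -(2 * Real.pi)⁻¹) - a (ξ + (2 * Real.pi)⁻¹))

theorem RapidDecay.sinShift {a : ℝ → ℂ} (ha : RapidDecay a) : RapidDecay (sinShift a) :=
  ((ha.comp_add _).sub (ha.comp_add _)).const_mul _

theorem fourierInv_sinShift {a : ℝ → ℂ} (ha : RapidDecay a) (x : ℝ) :
    𝓕⁻ (sinShift a) x = 𝓕⁻ a x * (Real.sin x : ℂ) := by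
  have h1 : 𝓕⁻ (sinShift a) x = 1 / (2 * Complex.I) * 𝓕⁻ (fun ξ =>
      a (ξ + -(2 * Real.pi)⁻¹) - a (ξ + (2 * Real.pi)⁻¹)) x := fourierInv_const_mul _ _ _
  rw [h1, fourierInv_sub (ha.comp_add _).integrable (ha.comp_add _).integrable,
    fourierInv_comp_add, fourierInv_comp_add, Complex.ofReal_sin, Complex.sin]
  have e1 : 2 * Real.pi * -(2 * Real.pi)⁻¹ * x = -x := by field_simp
  have e2 : 2 * Real.pi * (2 * Real.pi)⁻¹ * x = x := by field_simp
  rw [e1, e2, Complex.ofReal_neg, neg_neg]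
  field_simp
  rw [Complex.I_sq]
  ring

theorem norm_sinShift_sub_le {a b e : ℝ → ℂ} {r : ℝ} (hr : 0 ≤ r)
    (hab : ∀ ξ, ‖a ξ - b ξ‖ ≤ r * ‖e ξ‖) (ξ : ℝ) :
    ‖sinShift a ξ - sinShift b ξ‖ ≤
      r * (‖e (ξ + -(2 * Real.pi)⁻¹)‖ + ‖e (ξ + (2 * Real.pi)⁻¹)‖) := by
  have h1 := hab (ξ + -(2 * Real.pi)⁻¹)
  have h2 := hab (ξ + (2 * Real.pi)⁻¹)
  have e1 : sinShift a ξ - sinShift b ξ = 1 / (2 * Complex.I) *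
      ((a (ξ + -(2 * Real.pi)⁻¹) - b (ξ + -(2 * Real.pi)⁻¹)) -
        (a (ξ + (2 * Real.pi)⁻¹) - b (ξ + (2 * Real.pi)⁻¹))) := by
    simp only [sinShift]; ring
  have e2 : ‖(1 / (2 * Complex.I) : ℂ)‖ = 1 / 2 := by simp
  rw [e1, norm_mul, e2]
  have h3 := norm_sub_le (a (ξ + -(2 * Real.pi)⁻¹) - b (ξ + -(2 * Real.pi)⁻¹))
    (a (ξ + (2 * Real.pi)⁻¹) - b (ξ + (2 * Real.pi)⁻¹))
  have h4 : 0 ≤ r * (‖e (ξ + -(2 * Real.pi)⁻¹)‖ + ‖e (ξ + (2 * Real.pi)⁻¹)‖) := by positivity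
  linarith

theorem RapidDecay.norm_add_norm {a b : ℝ → ℂ} (ha : RapidDecay a) (hb : RapidDecay b) :
    RapidDecay fun ξ => ((‖a ξ‖ + ‖b ξ‖ : ℝ) : ℂ) := by
  refine ⟨Complex.continuous_ofReal.comp (ha.1.norm.add hb.1.norm), fun n => ?_⟩
  obtain ⟨A, hA⟩ := ha.2 n
  obtain ⟨B, hB⟩ := hb.2 n
  refine ⟨A + B, fun ξ => ?_⟩
  rw [Complex.norm_real, Real.norm_of_nonneg (by positivity), mul_add]
  exact add_le_add (hA ξ) (hB ξ)

/-! ### Transforms of f_c and u_c, and the limit c → ∞. -/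

/-- The Fourier transform of `f_c`. -/
def fHat (m c : ℝ) (ξ : ℝ) : ℂ := (symbolF m c (2 * Real.pi * ξ) : ℂ) * 𝓕 h ξ

/-- The Fourier transform of `h - h''`. -/
def errHat (ξ : ℝ) : ℂ := (((2 * Real.pi * ξ) ^ 2 + 1 : ℝ) : ℂ) * 𝓕 h ξ

/-- A rapidly decaying majorant of `c²` times the Fourier transform of `u_c - u_∞`, up to a
constant. -/
def majorant (ξ : ℝ) : ℝ := ‖errHat (ξ + -(2 * Real.pi)⁻¹)‖ + ‖errHat (ξ + (2 * Real.pi)⁻¹)‖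

theorem two_pi_mul_sq_add_one_le (ξ : ℝ) :
    (2 * Real.pi * ξ) ^ 2 + 1 ≤ (4 * Real.pi ^ 2 + 1) * (1 + ξ ^ 2) := by
  nlinarith [sq_nonneg Real.pi, sq_nonneg ξ]

theorem rapidDecay_errHat : RapidDecay errHat := by
  refine rapidDecay_fourier_h.mul (by fun_prop) (A := 4 * Real.pi ^ 2 + 1) fun ξ => ?_
  rw [Complex.norm_real, Real.norm_of_nonneg (by positivity)]
  exact two_pi_mul_sq_add_one_le ξ

theorem rapidDecay_majorant : RapidDecay fun ξ => (majorant ξ : ℂ) :=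
  (rapidDecay_errHat.comp_add _).norm_add_norm (rapidDecay_errHat.comp_add _)

theorem majorant_nonneg (ξ : ℝ) : 0 ≤ majorant ξ := by
  unfold majorant
  positivity

section Transforms

variable {m c : ℝ}

theorem rapidDecay_fHat (hm : 0 < m) (hc : 0 < c) : RapidDecay (fHat m c) := by
  refine rapidDecay_fourier_h.mul (by unfold symbolF; fun_prop)
    (A := 1 + 1 / (2 * m ^ 2 * c ^ 2) * (4 * Real.pi ^ 2 + 1)) fun ξ => ?_
  rw [Complex.norm_real, Real.norm_eq_abs]
  have h1 := abs_symbolF_sub_one_le hm hc (2 * Real.pi * ξ)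
  have h2 := abs_add_le (symbolF m c (2 * Real.pi * ξ) - 1) 1
  rw [sub_add_cancel, abs_one] at h2
  have h3 := mul_le_mul_of_nonneg_left (two_pi_mul_sq_add_one_le ξ)
    (show 0 ≤ 1 / (2 * m ^ 2 * c ^ 2) by positivity)
  nlinarith [sq_nonneg ξ]

theorem hasMomentumFun_f (hm : 0 < m) (hc : 0 < c) :
    HasMomentumFun (symbolF m c) h (𝓕⁻ (fHat m c)) := by
  have := rapidDecay_fourier_h.hasMomentumFun (rapidDecay_fHat hm hc) (K := symbolF m c)
    fun ξ => rfl
  rwa [fourierInv_fourier_h] at this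

theorem f_eq (hm : 0 < m) (hc : 0 < c) : f m c = 𝓕⁻ (fHat m c) :=
  (hasMomentumFun_f hm hc).momentumFun_eq

theorem u_eq (hm : 0 < m) (hc : 0 < c) : u m c = 𝓕⁻ (sinShift (fHat m c)) := by
  ext x
  rw [fourierInv_sinShift (rapidDecay_fHat hm hc), u, f_eq hm hc]

theorem uInf_eq : uInf = 𝓕⁻ (sinShift (𝓕 h)) := by
  ext x
  rw [fourierInv_sinShift rapidDecay_fourier_h, uInf, fourierInv_fourier_h, mul_comm]

theorem norm_sinShift_fHat_sub_le (hm : 0 < m) (hc : 0 < c) (ξ : ℝ) :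
    ‖sinShift (fHat m c) ξ - sinShift (𝓕 h) ξ‖ ≤ 1 / (2 * m ^ 2 * c ^ 2) * majorant ξ := by
  refine norm_sinShift_sub_le (by positivity) (fun ξ => ?_) ξ
  have e1 : fHat m c ξ - 𝓕 h ξ = ((symbolF m c (2 * Real.pi * ξ) - 1 : ℝ) : ℂ) * 𝓕 h ξ := by
    rw [fHat]; push_cast; ring
  rw [e1, errHat, norm_mul, norm_mul, ← mul_assoc, Complex.norm_real, Complex.norm_real,
    Real.norm_eq_abs, Real.norm_of_nonneg (by positivity : 0 ≤ (2 * Real.pi * ξ) ^ 2 + 1)]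
  gcongr
  exact abs_symbolF_sub_one_le hm hc _

/-- The sup norm is at most the L¹ norm of the transform, and j derivatives only insert (2πiξ)^j,
which the majorant absorbs; the bound does not depend on x. -/
theorem norm_iteratedDeriv_u_sub_le (hm : 0 < m) (hc : 0 < c) (j : ℕ) (x : ℝ) :
    ‖iteratedDeriv j (u m c) x - iteratedDeriv j uInf x‖ ≤
      1 / (2 * m ^ 2 * c ^ 2) * ∫ ξ : ℝ, ‖(2 * Real.pi * Complex.I * ξ) ^ j * majorant ξ‖ := by
  have hf := (rapidDecay_fHat hm hc).sinShift
  have hh := rapidDecay_fourier_h.sinShift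
  have h1 := hf.pow_mul (2 * Real.pi * Complex.I) j
  have h2 := hh.pow_mul (2 * Real.pi * Complex.I) j
  rw [u_eq hm hc, uInf_eq, hf.iteratedDeriv_fourierInv, hh.iteratedDeriv_fourierInv,
    ← fourierInv_sub h1.integrable h2.integrable]
  refine (norm_fourierInv_le _ _).trans ?_
  rw [← integral_const_mul]
  refine integral_mono (h1.sub h2).integrable.norm
    ((rapidDecay_majorant.pow_mul _ j).integrable.norm.const_mul _) fun ξ => ?_
  simp only
  rw [← mul_sub, norm_mul, norm_mul, Complex.norm_real, Real.norm_of_nonneg (majorant_nonneg ξ)]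
  calc _ ≤ ‖(2 * Real.pi * Complex.I * (ξ : ℂ)) ^ j‖ * (1 / (2 * m ^ 2 * c ^ 2) * majorant ξ) := by
        gcongr
        exact norm_sinShift_fHat_sub_le hm hc ξ
    _ = _ := by ring

theorem tendsto_const_div_sq (m C : ℝ) :
    Tendsto (fun c : ℝ => 1 / (2 * m ^ 2 * c ^ 2) * C) atTop (nhds 0) := by
  have h1 : Tendsto (fun c : ℝ => (c ^ 2)⁻¹) atTop (nhds 0) :=
    tendsto_inv_atTop_zero.comp (tendsto_pow_atTop two_ne_zero)
  have h2 := h1.const_mul ((2 * m ^ 2)⁻¹ * C)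
  rw [mul_zero] at h2
  refine h2.congr fun c => ?_
  rw [one_div, mul_inv]
  ring

theorem tendstoUniformly_iteratedDeriv_u (hm : 0 < m) (j : ℕ) :
    TendstoUniformly (fun c => iteratedDeriv j (u m c)) (iteratedDeriv j uInf) atTop := by
  rw [Metric.tendstoUniformly_iff]
  intro ε hε
  filter_upwards [(tendsto_const_div_sq m _).eventually (gt_mem_nhds hε), eventually_gt_atTop 0]
    with c h1 hc x
  rw [dist_comm, dist_eq_norm]
  exact (norm_iteratedDeriv_u_sub_le hm hc j x).trans_lt h1

/-- The Fourier transform of `(√(p² + m²c²) - mc) u_c`. -/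
def kinHat (m c : ℝ) (ξ : ℝ) : ℂ :=
  (symbolKin m c (2 * Real.pi * ξ) : ℂ) * sinShift (fHat m c) ξ

theorem rapidDecay_kinHat (hm : 0 < m) (hc : 0 < c) : RapidDecay (kinHat m c) := by
  refine (rapidDecay_fHat hm hc).sinShift.mul (by unfold symbolKin; fun_prop)
    (A := 1 / (2 * (m * c)) * (4 * Real.pi ^ 2 + 1)) fun ξ => ?_
  rw [Complex.norm_real, Real.norm_of_nonneg (symbolKin_nonneg _ _ _)]
  refine (symbolKin_le hm hc _).trans ?_
  have h1 : (2 * Real.pi * ξ) ^ 2 ≤ (4 * Real.pi ^ 2 + 1) * (1 + ξ ^ 2) := by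
    linarith [two_pi_mul_sq_add_one_le ξ]
  calc (2 * Real.pi * ξ) ^ 2 / (2 * (m * c))
      ≤ (4 * Real.pi ^ 2 + 1) * (1 + ξ ^ 2) / (2 * (m * c)) := by gcongr
    _ = 1 / (2 * (m * c)) * (4 * Real.pi ^ 2 + 1) * (1 + ξ ^ 2) := by ring

theorem hasMomentumFun_u (hm : 0 < m) (hc : 0 < c) :
    HasMomentumFun (symbolKin m c) (u m c) (𝓕⁻ (kinHat m c)) := by
  rw [u_eq hm hc]
  exact (rapidDecay_fHat hm hc).sinShift.hasMomentumFun (rapidDecay_kinHat hm hc) fun ξ => rfl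

theorem momentumFun_u (hm : 0 < m) (hc : 0 < c) :
    momentumFun (symbolKin m c) (u m c) = 𝓕⁻ (kinHat m c) :=
  (hasMomentumFun_u hm hc).momentumFun_eq

theorem contDiff_u (hm : 0 < m) (hc : 0 < c) (n : ℕ) : ContDiff ℝ n (u m c) := by
  rw [u_eq hm hc]
  exact (rapidDecay_fHat hm hc).sinShift.contDiff_fourierInv n

theorem contDiff_uInf (n : ℕ) : ContDiff ℝ n uInf := by
  rw [uInf_eq]
  exact rapidDecay_fourier_h.sinShift.contDiff_fourierInv n

theorem tendsto_sinShift_fHat (hm : 0 < m) (ξ : ℝ) :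
    Tendsto (fun c => sinShift (fHat m c) ξ) atTop (nhds (sinShift (𝓕 h) ξ)) := by
  rw [tendsto_iff_norm_sub_tendsto_zero]
  refine squeeze_zero' (Eventually.of_forall fun c => norm_nonneg _) ?_
    (tendsto_const_div_sq m (majorant ξ))
  filter_upwards [eventually_gt_atTop 0] with c hc
  exact norm_sinShift_fHat_sub_le hm hc ξ

theorem momentum_momentum (φ : ℝ → ℂ) (x : ℝ) :
    momentum (momentum φ) x = -iteratedDeriv 2 φ x := by
  have h1 : momentum φ = fun x => -Complex.I * deriv φ x := rfl
  rw [momentum, h1, deriv_const_mul_field, iteratedDeriv_succ, iteratedDeriv_one, ← mul_assoc,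
    neg_mul_neg, Complex.I_mul_I, neg_one_mul]

/-- The relativistic kinetic term converges pointwise to the nonrelativistic one. -/
theorem tendsto_kinetic (hm : 0 < m) (x : ℝ) :
    Tendsto (fun c : ℝ => (c : ℂ) * momentumFun (symbolKin m c) (u m c) x) atTop
      (nhds (1 / (2 * m) * momentum (momentum uInf) x)) := by
  have hh := rapidDecay_fourier_h.sinShift
  have hlim : 1 / (2 * m) * momentum (momentum uInf) x =
      𝓕⁻ (fun ξ : ℝ => (((2 * Real.pi * ξ) ^ 2 / (2 * m) : ℝ) : ℂ) * sinShift (𝓕 h) ξ) x := by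
    have e : (fun ξ : ℝ => (((2 * Real.pi * ξ) ^ 2 / (2 * m) : ℝ) : ℂ) * sinShift (𝓕 h) ξ) =
        fun ξ : ℝ => -(1 / (2 * m)) *
          ((2 * Real.pi * Complex.I * ξ) ^ 2 * sinShift (𝓕 h) ξ) := by
      ext ξ
      push_cast
      linear_combination (4 * Real.pi ^ 2 * ξ ^ 2 / (2 * m) * sinShift (𝓕 h) ξ : ℂ) * Complex.I_sq
    rw [e, fourierInv_const_mul, momentum_momentum, uInf_eq, hh.iteratedDeriv_fourierInv]
    ring
  rw [hlim]
  -- The dominating function combines c·K_c(k) ≤ k²/(2m) with the majorant bound for the transform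
  -- of u_c, in which c⁻² is replaced by 1 once c ≥ 1.
  set B : ℝ → ℝ := fun ξ => 1 / (2 * m) * (‖(2 * Real.pi * (ξ : ℂ)) ^ 2 * sinShift (𝓕 h) ξ‖ +
    1 / (2 * m ^ 2) * ‖(2 * Real.pi * (ξ : ℂ)) ^ 2 * majorant ξ‖)
  have hB : Integrable B :=
    ((hh.pow_mul _ 2).integrable.norm.add
      ((rapidDecay_majorant.pow_mul _ 2).integrable.norm.const_mul _)).const_mul _
  have hT : Tendsto (fun c : ℝ => 𝓕⁻ (fun ξ => (c : ℂ) * kinHat m c ξ) x) atTop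
      (nhds (𝓕⁻ (fun ξ : ℝ =>
        (((2 * Real.pi * ξ) ^ 2 / (2 * m) : ℝ) : ℂ) * sinShift (𝓕 h) ξ) x)) := by
    refine tendsto_fourierInv (B := B) ?_ hB ?_ (fun ξ => ?_) x
    · filter_upwards [eventually_gt_atTop 0] with c hc
      exact ((rapidDecay_kinHat hm hc).const_mul _).1.aestronglyMeasurable
    · filter_upwards [eventually_ge_atTop 1] with c hc ξ
      have hc0 : 0 < c := by linarith
      have h1 := norm_sinShift_fHat_sub_le hm hc0 ξ
      have h2 := norm_le_norm_add_norm_sub' (sinShift (fHat m c) ξ) (sinShift (𝓕 h) ξ)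
      have h3 : 1 / (2 * m ^ 2 * c ^ 2) * majorant ξ ≤ 1 / (2 * m ^ 2) * majorant ξ := by
        refine mul_le_mul_of_nonneg_right (one_div_le_one_div_of_le (by positivity) ?_)
          (majorant_nonneg ξ)
        exact le_mul_of_one_le_right (by positivity) (one_le_pow₀ hc)
      have e1 : ‖(2 * Real.pi * (ξ : ℂ)) ^ 2‖ = (2 * Real.pi * ξ) ^ 2 := by
        rw [norm_pow, ← Complex.ofReal_ofNat, ← Complex.ofReal_mul, ← Complex.ofReal_mul,
          Complex.norm_real, Real.norm_eq_abs, sq_abs]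
      have e2 : ‖(c : ℂ) * kinHat m c ξ‖ =
          c * symbolKin m c (2 * Real.pi * ξ) * ‖sinShift (fHat m c) ξ‖ := by
        rw [kinHat, norm_mul, norm_mul, Complex.norm_real, Complex.norm_real,
          Real.norm_of_nonneg hc0.le, Real.norm_of_nonneg (symbolKin_nonneg _ _ _), ← mul_assoc]
      calc ‖(c : ℂ) * kinHat m c ξ‖
          ≤ (2 * Real.pi * ξ) ^ 2 / (2 * m) *
              (‖sinShift (𝓕 h) ξ‖ + 1 / (2 * m ^ 2) * majorant ξ) := by
            rw [e2]
            gcongr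
            · exact mul_symbolKin_le hm hc0 _
            · linarith
        _ = B ξ := by
            simp only [B]
            rw [norm_mul, norm_mul, e1, Complex.norm_real, Real.norm_of_nonneg (majorant_nonneg ξ)]
            ring
    · have h1 := ((Complex.continuous_ofReal.tendsto _).comp
        (tendsto_mul_symbolKin hm (2 * Real.pi * ξ))).mul (tendsto_sinShift_fHat hm ξ)
      refine h1.congr fun c => ?_
      simp only [Function.comp_apply, kinHat]
      push_cast
      ring
  refine hT.congr' ?_
  filter_upwards [eventually_gt_atTop 0] with c hc
  rw [fourierInv_const_mul, momentumFun_u hm hc]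

end Transforms

/-! ### Convergence of the potentials and closed form of the limit. -/

theorem uInf_ne_zero {x : ℝ} (hx : ∀ n : ℤ, x ≠ n * Real.pi) : uInf x ≠ 0 := by
  have h1 : Real.sin x ≠ 0 := Real.sin_ne_zero_iff.2 fun n => (hx n).symm
  have h2 := (one_add_g_sq_pos x).ne'
  simp only [uInf, h, ← Complex.ofReal_mul, ne_eq, Complex.ofReal_eq_zero]
  positivity

theorem tendsto_V {m : ℝ} (hm : 0 < m) {x : ℝ} (hx : ∀ n : ℤ, x ≠ n * Real.pi) :
    Tendsto (fun c => V m c x) atTop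
      (nhds ((1 / (2 * m) : ℂ) * (1 - momentum (momentum uInf) x / uInf x))) := by
  have h1 : Tendsto (fun c => u m c x) atTop (nhds (uInf x)) := by
    simpa using (tendstoUniformly_iteratedDeriv_u hm 0).tendsto_at x
  have h2 := ((Complex.continuous_ofReal.tendsto _).comp (tendsto_lam hm)).sub
    ((tendsto_kinetic hm x).div h1 (uInf_ne_zero hx))
  have e : ((1 / (2 * m) : ℝ) : ℂ) - 1 / (2 * m) * momentum (momentum uInf) x / uInf x =
      (1 / (2 * m) : ℂ) * (1 - momentum (momentum uInf) x / uInf x) := by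
    push_cast
    ring
  rw [← e]
  refine h2.congr fun c => ?_
  simp only [V, Function.comp_apply, Pi.div_apply, mul_div_assoc]

theorem hasDerivAt_g' (x : ℝ) : HasDerivAt g (4 * Real.sin x ^ 2) x :=
  (hasDerivAt_g x).congr_deriv (by rw [Real.cos_two_mul, Real.cos_sq']; ring)

/-- The terms are kept as the product and quotient rules produce them. Each contains a factor sin x,
supplied by g' = 4 sin² where sin itself is differentiated, so division by u_∞ leaves no pole. -/
theorem iteratedDeriv_two_uInf (x : ℝ) : iteratedDeriv 2 uInf x =
    ((-Real.sin x / (1 + g x ^ 2) - 8 * Real.sin x ^ 2 * Real.cos x * g x / (1 + g x ^ 2) ^ 2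
      - 24 * Real.sin x ^ 2 * Real.cos x * g x / (1 + g x ^ 2) ^ 2
      - 32 * Real.sin x ^ 5 / (1 + g x ^ 2) ^ 2
      + 128 * Real.sin x ^ 5 * g x ^ 2 / (1 + g x ^ 2) ^ 3 : ℝ) : ℂ) := by
  have hd : ∀ x, HasDerivAt (fun y => 1 + g y ^ 2) (8 * g x * Real.sin x ^ 2) x := fun x =>
    (((hasDerivAt_g' x).pow 2).const_add 1).congr_deriv (by ring)
  have hne : ∀ x, 1 + g x ^ 2 ≠ 0 := fun x => (one_add_g_sq_pos x).ne'
  have e0 : uInf = fun x => ((Real.sin x / (1 + g x ^ 2) : ℝ) : ℂ) := by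
    ext x
    rw [uInf, h, ← Complex.ofReal_mul, mul_one_div]
  have e1 : deriv uInf = fun x => ((Real.cos x / (1 + g x ^ 2)
      - 8 * (Real.sin x ^ 3 * g x) / (1 + g x ^ 2) ^ 2 : ℝ) : ℂ) := by
    ext x
    rw [e0]
    refine HasDerivAt.deriv (HasDerivAt.ofReal_comp ?_)
    refine ((Real.hasDerivAt_sin x).div (hd x) (hne x)).congr_deriv ?_
    have := hne x
    field_simp
  rw [iteratedDeriv_succ, iteratedDeriv_one, e1]
  refine HasDerivAt.deriv (HasDerivAt.ofReal_comp ?_)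
  have h1 := (Real.hasDerivAt_cos x).div (hd x) (hne x)
  have h2 := (((((Real.hasDerivAt_sin x).pow 3).mul (hasDerivAt_g' x)).const_mul 8).div
    ((hd x).pow 2) (pow_ne_zero 2 (hne x)))
  refine (h1.sub h2).congr_deriv ?_
  have := hne x
  simp only [Pi.pow_apply, Pi.mul_apply]
  field_simp
  ring

/-- Since g and sin are odd and cos is even, the formula is even in x and the absolute values can be
dropped. -/
theorem VNW_eq (x : ℝ) : VNW x =
    -32 * (Real.sin x * (g x ^ 3 * Real.cos x - 3 * g x ^ 2 * Real.sin x ^ 3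
      + g x * Real.cos x + Real.sin x ^ 3)) / (1 + g x ^ 2) ^ 2 := by
  rcases abs_choice x with hx | hx
  · rw [VNW, hx]
  · have hg : g (-x) = -g x := by
      rw [g, g, mul_neg, Real.sin_neg]; ring
    rw [VNW, hx, hg, Real.sin_neg, Real.cos_neg]
    ring

theorem one_sub_momentum_div_uInf {x : ℝ} (hx : ∀ n : ℤ, x ≠ n * Real.pi) :
    1 - momentum (momentum uInf) x / uInf x = (VNW x : ℂ) := by
  have h1 : Real.sin x ≠ 0 := Real.sin_ne_zero_iff.2 fun n => (hx n).symm
  have h2 := (one_add_g_sq_pos x).ne'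
  rw [momentum_momentum, iteratedDeriv_two_uInf, VNW_eq, uInf, h]
  rw [← Complex.ofReal_mul, ← Complex.ofReal_neg, ← Complex.ofReal_div, ← Complex.ofReal_one,
    ← Complex.ofReal_sub]
  congr 1
  -- The term −sin x/(1 + g²) of u_∞'' contributes −1 and cancels the leading 1; over (1 + g²)² the
  -- sin³ terms combine as (1 + g²) − 4g² = 1 − 3g².
  field_simp
  ring

end NeumannWigner

end

theorem theorem2 (m : ℝ) (hm : 0 < m) :
    -- all objects are well defined, for every `c > 0`
    (∀ c : ℝ, 0 < c →
      NeumannWigner.HasMomentumFun (NeumannWigner.symbolF m c) NeumannWigner.h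
        (NeumannWigner.f m c) ∧
      ContDiff ℝ 2 (NeumannWigner.u m c) ∧
      NeumannWigner.HasMomentumFun (NeumannWigner.symbolKin m c) (NeumannWigner.u m c)
        (NeumannWigner.momentumFun (NeumannWigner.symbolKin m c) (NeumannWigner.u m c))) ∧
    -- `u_c → u_∞` uniformly in `C²(ℝ)`
    (ContDiff ℝ 2 NeumannWigner.uInf ∧
      ∀ j : ℕ, j ≤ 2 →
        TendstoUniformly (fun c : ℝ => iteratedDeriv j (NeumannWigner.u m c))
          (iteratedDeriv j NeumannWigner.uInf) Filter.atTop) ∧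
    -- `λ_c → 1 / (2m)`
    Filter.Tendsto (NeumannWigner.lam m) Filter.atTop (nhds (1 / (2 * m))) ∧
    -- pointwise convergence of the potentials off `πℤ`, and the limit in closed form
    (∀ x : ℝ, (∀ n : ℤ, x ≠ n * Real.pi) →
      Filter.Tendsto (fun c : ℝ => NeumannWigner.V m c x) Filter.atTop
        (nhds ((1 / (2 * m) : ℂ) *
          (1 - NeumannWigner.momentum (NeumannWigner.momentum NeumannWigner.uInf) x
            / NeumannWigner.uInf x))) ∧
      (1 / (2 * m) : ℂ) *
          (1 - NeumannWigner.momentum (NeumannWigner.momentum NeumannWigner.uInf) x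
            / NeumannWigner.uInf x) =
        ((1 / (2 * m) * NeumannWigner.VNW x : ℝ) : ℂ)) := by
  refine ⟨fun c hc => ⟨?_, NeumannWigner.contDiff_u hm hc 2, ?_⟩,
    ⟨NeumannWigner.contDiff_uInf 2, fun j _ => NeumannWigner.tendstoUniformly_iteratedDeriv_u hm j⟩,
    NeumannWigner.tendsto_lam hm, fun x hx => ⟨NeumannWigner.tendsto_V hm hx, ?_⟩⟩
  · rw [NeumannWigner.f_eq hm hc]
    exact NeumannWigner.hasMomentumFun_f hm hc
  · rw [NeumannWigner.momentumFun_u hm hc]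
    exact NeumannWigner.hasMomentumFun_u hm hc
  · rw [NeumannWigner.one_sub_momentum_div_uInf hx]
    push_cast
    rfl
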